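/- Let $\mathbb{N}=\{1,2,\dots\}$ and let $H$ be a self-adjoint operator on $l^2(\mathbb{N};\mathbb{C}^N)$ acting by $$[H\psi]_m = A(m-1)^*\psi_{m-1}+V(m)\psi_m+A(m)\psi_{m+1},\qquad m\in\mathbb{N},\quad \psi_0:=0,$$ with complex $N\times N$ matrices $A(m)$ and Hermitian $N\times N$ matrices $V(m)$, $m \in \mathbb{N}$. Suppose that $M\ge 0$ is an integer such that $A(m+1)=A(m)$ and $V(m+1)=V(m)$ for all $m\in\mathbb{N}$ with $m\ge M$, and let $A^\infty$, $V^\infty$ denote the common values of $A(m)$, $V(m)$ for $m\in\mathbb{N}$, $m\geq M$. Let $z\in\mathbb{C}\setminus\sigma(H)$ and put $$S(z)=\begin{bmatrix}-A^\infty&0\\ z-V^\infty&-A^\infty\end{bmatrix}\in\mathbb{C}^{2N\times 2N}.$$ Assume that $S(z)$ is either invertible or of the form $$S(z)=\begin{bmatrix}0&0&0\\ M_{11}&M_{12}&0\\ M_{21}&M_{22}&0\end{bmatrix}$$ with row and column blocks of sizes $n,2k,n$, where $k=N-n>0$, such that $M_{21}$ and $M_{12}-M_{11}M_{21}^{-1}M_{22}$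 are invertible. Then there is an $N$-dimensional subspace $V_{\rm decaying}\subset\mathbb{C}^{2N}$, depending only on $A^\infty,V^\infty,z$ (namely the set of all $[h_1,h_2]^{\mathsf T}$ where $h\in l^2(\mathbb{N};\mathbb{C}^N)$ satisfies $-(A^\infty)^*h_{m-1}+(z-V^\infty)h_m-A^\infty h_{m+1}=0$ for all $m\ge 2$), with the following property. For every right-hand side $(f_m)_{m\in\mathbb{N}}$ in $\mathbb{C}^N$ with $f_m=0$ for $m>M$, the system $$-A(m-1)^*g_{m-1}+(z-V(m))g_m-A(m)g_{m+1}=f_m\quad(m\in\mathbb{N}),\qquad g_0=0,$$ has a unique solution $g\in l^2(\mathbb{N};\mathbb{C}^N)$, and $(g_1,\dots,g_{M+2})$ is the unique solution in $(\mathbb{C}^N)^{M+2}$ of the truncated problem consisting of the equations $m=1,\dots,M+1$ of this system (with $g_0=0$) and the boundary condition $[g_{M+1},g_{M+2}]^{\mathsf T}\in V_{\rm decaying}$. -/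

import Mathlib

open Matrix

noncomputable section

namespace EventuallyPeriodic

/-- The Hilbert space `l²(ℕ; ℂ^N)`, with `ℕ = {1, 2, …}`. -/
abbrev L2 (N : ℕ) : Type := lp (fun _ : ℕ+ => EuclideanSpace ℂ (Fin N)) 2

/-- The cells `ψ_1, ψ_2, …` of `ψ`, extended by `ψ_0 = 0`. -/
def cell {N : ℕ} (ψ : L2 N) : ℕ → Fin N → ℂ
  | 0 => 0
  | m + 1 => fun i => ψ m.succPNat i

/-- The cells `u_1, …, u_K` of a finite block vector (`u_m` is stored at index `m - 1`),
extended by zero to all other cell numbers. -/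
def finCell {N K : ℕ} (u : Fin K → Fin N → ℂ) : ℕ → Fin N → ℂ
  | 0 => 0
  | m + 1 => if h : m < K then u ⟨m, h⟩ else 0

/-- `H` is a self-adjoint operator on `l²(ℕ; ℂ^N)` of range `R = 1`:
`[Hψ]_m = A(m-1)^* ψ_{m-1} + V(m) ψ_m + A(m) ψ_{m+1}` for all `m ≥ 1`, with `V(m)` Hermitian.
The values `A 0` and `V 0` play no role, because `ψ_0 = 0`. -/
structure IsNearestNeighbour {N : ℕ} (H : L2 N →L[ℂ] L2 N)
    (A V : ℕ → Matrix (Fin N) (Fin N) ℂ) : Prop where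
  selfAdjoint : IsSelfAdjoint H
  hermitian : ∀ m, 1 ≤ m → (V m).IsHermitian
  action : ∀ (ψ : L2 N) (m : ℕ), 1 ≤ m →
    cell (H ψ) m
      = (A (m - 1))ᴴ *ᵥ cell ψ (m - 1) + V m *ᵥ cell ψ m + A m *ᵥ cell ψ (m + 1)

/-- The coefficients are constant from cell `M` on. -/
def IsPeriodicFrom {N : ℕ} (M : ℕ) (A V : ℕ → Matrix (Fin N) (Fin N) ℂ) : Prop :=
  ∀ m, 1 ≤ m → M ≤ m → V (m + 1) = V m ∧ A (m + 1) = A m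

/-- `-A(m-1)^* g_{m-1} + (z - V(m)) g_m - A(m) g_{m+1}`. -/
def greenLHS {N : ℕ} (A V : ℕ → Matrix (Fin N) (Fin N) ℂ) (z : ℂ)
    (g : ℕ → Fin N → ℂ) (m : ℕ) : Fin N → ℂ :=
  -((A (m - 1))ᴴ *ᵥ g (m - 1)) + (z • (1 : Matrix (Fin N) (Fin N) ℂ) - V m) *ᵥ g m
    - A m *ᵥ g (m + 1)

/-- `g ∈ l²(ℕ; ℂ^N)` solves the difference equation with right-hand side `f` in all cells. -/
def SolvesGreen {N : ℕ} (A V : ℕ → Matrix (Fin N) (Fin N) ℂ) (z : ℂ)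
    (f : ℕ → Fin N → ℂ) (g : L2 N) : Prop :=
  ∀ m, 1 ≤ m → greenLHS A V z (cell g) m = f m

/-- `u = (u_1, …, u_{M+2})` solves the system truncated after `M + 2` cells: these are the
equations `m = 1, …, M + 1`, which are all the equations involving no cell after `M + 2`. -/
def SolvesTruncated {N : ℕ} (M : ℕ) (A V : ℕ → Matrix (Fin N) (Fin N) ℂ) (z : ℂ)
    (f : ℕ → Fin N → ℂ) (u : Fin (M + 2) → Fin N → ℂ) : Prop :=
  ∀ m, 1 ≤ m → m ≤ M + 1 → greenLHS A V z (finCell u) m = f m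

/-- The matrix `S(z) = [[-A, 0], [z - V, -A]]`. -/
def SMatrix {N : ℕ} (A V : Matrix (Fin N) (Fin N) ℂ) (z : ℂ) :
    Matrix (Fin N ⊕ Fin N) (Fin N ⊕ Fin N) ℂ :=
  fromBlocks (-A) 0 (z • (1 : Matrix (Fin N) (Fin N) ℂ) - V) (-A)

/-- The order-preserving splitting of the rows of a `2N × 2N` matrix (`N = n + m`) into
consecutive groups of `n`, `2m`, `n`. -/
def rowSplit {N n m : ℕ} (h : n + m = N) :
    Fin n ⊕ (Fin (2 * m) ⊕ Fin n) ≃ Fin N ⊕ Fin N :=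
  ((Equiv.sumCongr (Equiv.refl _) finSumFinEquiv).trans finSumFinEquiv).trans
    ((finCongr (by omega)).trans finSumFinEquiv.symm)

/-- The order-preserving splitting of the columns of a `2N × 2N` matrix (`N = n + m`) into
consecutive groups of `n`, `2m`, `n`. -/
def colSplit {N n m : ℕ} (h : n + m = N) :
    (Fin n ⊕ Fin (2 * m)) ⊕ Fin n ≃ Fin N ⊕ Fin N :=
  ((Equiv.sumCongr finSumFinEquiv (Equiv.refl _)).trans finSumFinEquiv).trans
    ((finCongr (by omega)).trans finSumFinEquiv.symm)

/-- `S = [[0, 0, 0], [M₁₁, M₁₂, 0], [M₂₁, M₂₂, 0]]` with row and column groups of sizes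
`n, 2m, n`, where `m = N - n > 0`, and with `M₂₁` and `M₁₂ - M₁₁ M₂₁⁻¹ M₂₂` invertible. -/
def HasSingularForm {N : ℕ} (S : Matrix (Fin N ⊕ Fin N) (Fin N ⊕ Fin N) ℂ) : Prop :=
  ∃ (n m : ℕ) (h : n + m = N) (M₁₁ : Matrix (Fin (2 * m)) (Fin n) ℂ)
    (M₁₂ : Matrix (Fin (2 * m)) (Fin (2 * m)) ℂ) (M₂₁ : Matrix (Fin n) (Fin n) ℂ)
    (M₂₂ : Matrix (Fin n) (Fin (2 * m)) ℂ),
    0 < m ∧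
    S.submatrix (rowSplit h) (colSplit h)
      = fromBlocks 0 0 (fromBlocks M₁₁ M₁₂ M₂₁ M₂₂) 0 ∧
    IsUnit M₂₁ ∧ IsUnit (M₁₂ - M₁₁ * M₂₁⁻¹ * M₂₂)

/-- `x = [h_1, h_2]` for some `h ∈ l²(ℕ; ℂ^N)` with
`-A^* h_{m-1} + (z - V) h_m - A h_{m+1} = 0` for all `m ≥ 2`, where `A`, `V` do not depend
on `m`. -/
def IsDecayingData {N : ℕ} (A V : Matrix (Fin N) (Fin N) ℂ) (z : ℂ)
    (x : Fin N ⊕ Fin N → ℂ) : Prop :=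
  ∃ h : L2 N, (∀ m, 2 ≤ m → greenLHS (fun _ => A) (fun _ => V) z (cell h) m = 0) ∧
    x = Sum.elim (cell h 1) (cell h 2)

end EventuallyPeriodic

end

/-!
The sequences in `l²` that solve the homogeneous equation from cell `M + 2` on are the inverse image
under `z - H` of the sequences supported in the cells `1, …, M + 1`, so they form a space of
dimension `(M + 1) N`. Taking the cells `M + 1` and `M + 2` maps this space onto `V_decaying`, and
the kernel consists of the sequences supported in the cells `1, …, M`: if both cells vanish, then
replacing the first `M` cells by zero gives a solution of the homogeneous equation in all cells,
which is zero because `z ∉ σ(H)`. Hence `dim V_decaying = (M + 1) N - M N = N`.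

A solution of the truncated problem is continued beyond cell `M + 2` by the `l²` sequence that
witnesses its boundary condition, and uniqueness in `l²` identifies the result.
-/

noncomputable section

namespace EventuallyPeriodic

variable {N : ℕ}

theorem finrank_map_add_finrank_inf_ker {K E F : Type*} [DivisionRing K] [AddCommGroup E]
    [Module K E] [AddCommGroup F] [Module K F] (f : E →ₗ[K] F) (p : Submodule K E)
    [FiniteDimensional K p] :
    Module.finrank K (p.map f) + Module.finrank K (p ⊓ LinearMap.ker f : Submodule K E)
      = Module.finrank K p := by
  rw [← LinearMap.range_domRestrict, ← (f.domRestrict p).finrank_range_add_finrank_ker,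
    LinearMap.ker_domRestrict, ← Submodule.finrank_map_subtype_eq, Submodule.map_comap_subtype]

theorem cell_ext {φ ψ : L2 N} (h : ∀ m, 1 ≤ m → cell φ m = cell ψ m) : φ = ψ := by
  ext p i
  simpa [cell] using congrFun (h (p.natPred + 1) (by lia)) i

/-- The linear map `ψ ↦ ψ_m`. -/
def cellₗ (N m : ℕ) : L2 N →ₗ[ℂ] Fin N → ℂ where
  toFun ψ := cell ψ m
  map_add' φ ψ := by cases m <;> ext i <;> simp [cell]
  map_smul' c ψ := by cases m <;> ext i <;> simp [cell]

@[simp]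
theorem cellₗ_apply (m : ℕ) (ψ : L2 N) : cellₗ N m ψ = cell ψ m := rfl

theorem cell_zero (m : ℕ) : cell (0 : L2 N) m = 0 :=
  map_zero (cellₗ N m)

theorem cell_sub (φ ψ : L2 N) (m : ℕ) : cell (φ - ψ) m = cell φ m - cell ψ m :=
  map_sub (cellₗ N m) φ ψ

theorem cell_smul (c : ℂ) (ψ : L2 N) (m : ℕ) : cell (c • ψ) m = c • cell ψ m :=
  map_smul (cellₗ N m) c ψ

theorem exists_cell_eq_iff_summable (c : ℕ → Fin N → ℂ) :
    (∃ ψ : L2 N, ∀ m, 1 ≤ m → cell ψ m = c m) ↔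
      Summable fun m => ‖WithLp.toLp 2 (c m)‖ ^ 2 := by
  have memℓp_iff : Memℓp (fun p : ℕ+ => WithLp.toLp 2 (c p)) 2 ↔
      Summable fun m => ‖WithLp.toLp 2 (c m)‖ ^ 2 := by
    rw [memℓp_gen_iff (by norm_num), ← summable_pnat_iff_summable_nat]
    simp
  rw [← memℓp_iff]
  constructor
  · rintro ⟨ψ, hψ⟩
    have hcells : (fun p : ℕ+ => WithLp.toLp 2 (c p)) = ψ := by
      ext p i
      rw [← hψ p p.pos, ← PNat.natPred_add_one p]
      simp [cell]
    exact hcells ▸ lp.memℓp ψ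
  · intro hc
    refine ⟨⟨_, hc⟩, fun m hm => ?_⟩
    obtain ⟨m, rfl⟩ := Nat.exists_eq_add_of_le' hm
    rfl

theorem exists_cell_eq_of_tail {c : ℕ → Fin N → ℂ} (j k : ℕ) (ψ : L2 N)
    (hc : ∀ m, 1 ≤ m → c (m + j) = cell ψ (m + k)) :
    ∃ φ : L2 N, ∀ m, 1 ≤ m → cell φ m = c m := by
  have hψ := (exists_cell_eq_iff_summable (cell ψ)).1 ⟨ψ, fun _ _ => rfl⟩
  rw [exists_cell_eq_iff_summable, ← summable_nat_add_iff (j + 1)]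
  convert (summable_nat_add_iff (k + 1)).2 hψ using 5 with m
  rw [← add_assoc, ← add_assoc, add_right_comm m j, add_right_comm m k, hc (m + 1) (by lia)]

theorem exists_cell_eq_of_forall_lt_eq_zero {K : ℕ} {c : ℕ → Fin N → ℂ}
    (hc : ∀ m, K < m → c m = 0) : ∃ φ : L2 N, ∀ m, 1 ≤ m → cell φ m = c m :=
  exists_cell_eq_of_tail K 0 0 fun m hm => by
    rw [hc (m + K) (by lia), cell_zero]

/-- The sequences supported in the cells `1, …, K`. -/
def cellsUpTo (N K : ℕ) : Submodule ℂ (L2 N) :=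
  ⨅ m > K, LinearMap.ker (cellₗ N m)

theorem mem_cellsUpTo {K : ℕ} {ψ : L2 N} : ψ ∈ cellsUpTo N K ↔ ∀ m > K, cell ψ m = 0 := by
  simp [cellsUpTo]

/-- A sequence supported in the cells `1, …, K` is given by these cells. -/
def cellsUpToEquiv (N K : ℕ) : cellsUpTo N K ≃ₗ[ℂ] (Fin K → Fin N → ℂ) :=
  LinearEquiv.ofBijective
    ((LinearMap.pi fun j : Fin K => cellₗ N (j + 1)).domRestrict (cellsUpTo N K)) <| by
    constructor
    · rintro ⟨φ, hφ⟩ ⟨ψ, hψ⟩ heq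
      refine Subtype.ext (cell_ext fun m hm => ?_)
      obtain ⟨m, rfl⟩ := Nat.exists_eq_add_of_le' hm
      rcases lt_or_ge m K with hmK | hmK
      · exact congrFun heq ⟨m, hmK⟩
      · rw [mem_cellsUpTo.1 hφ (m + 1) (by lia), mem_cellsUpTo.1 hψ (m + 1) (by lia)]
    · intro u
      have hu : ∀ m, K < m → finCell u m = 0
        | m + 1, hm => dif_neg (by lia)
      obtain ⟨φ, hφ⟩ := exists_cell_eq_of_forall_lt_eq_zero hu
      refine ⟨⟨φ, mem_cellsUpTo.2 fun m hm => (hφ m (by lia)).trans (hu m hm)⟩, ?_⟩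
      exact funext fun j => (hφ (j + 1) (by lia)).trans (dif_pos j.2)

instance (K : ℕ) : FiniteDimensional ℂ (cellsUpTo N K) :=
  .equiv (cellsUpToEquiv N K).symm

theorem finrank_cellsUpTo (K : ℕ) : Module.finrank ℂ (cellsUpTo N K) = K * N := by
  simp [(cellsUpToEquiv N K).finrank_eq, Module.finrank_pi_fintype]

/-- The linear map `ψ ↦ [ψ_{k+1}, ψ_{k+2}]`. -/
def cellPair (N k : ℕ) : L2 N →ₗ[ℂ] Fin N ⊕ Fin N → ℂ :=
  (LinearEquiv.sumArrowLequivProdArrow _ _ ℂ ℂ).symm.toLinearMap ∘ₗ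
    (cellₗ N (k + 1)).prod (cellₗ N (k + 2))

theorem cellPair_apply (k : ℕ) (ψ : L2 N) :
    cellPair N k ψ = Sum.elim (cell ψ (k + 1)) (cell ψ (k + 2)) := by
  ext (i | i) <;> rfl

theorem cellPair_eq_of_shift {k : ℕ} {g h : L2 N}
    (hgh : ∀ m, 1 ≤ m → cell g (m + k) = cell h m) : cellPair N k g = cellPair N 0 h := by
  rw [cellPair_apply, cellPair_apply, add_comm k, add_comm k, hgh 1 le_rfl, hgh 2 one_le_two]

theorem cellPair_eq_zero_iff {k : ℕ} {ψ : L2 N} :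
    cellPair N k ψ = 0 ↔ cell ψ (k + 1) = 0 ∧ cell ψ (k + 2) = 0 := by
  simp [cellPair]

section DifferenceEquation

variable {A V : ℕ → Matrix (Fin N) (Fin N) ℂ} {z : ℂ}

theorem greenLHS_congr {A' V' : ℕ → Matrix (Fin N) (Fin N) ℂ} {c d : ℕ → Fin N → ℂ} {m n : ℕ}
    (hA₀ : A (m - 1) = A' (n - 1)) (hA : A m = A' n) (hV : V m = V' n)
    (h₀ : c (m - 1) = d (n - 1)) (h₁ : c m = d n) (h₂ : c (m + 1) = d (n + 1)) :
    greenLHS A V z c m = greenLHS A' V' z d n := by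
  simp only [greenLHS, hA₀, hA, hV, h₀, h₁, h₂]

theorem greenLHS_eq_of_cells_eq {c d : ℕ → Fin N → ℂ} {m : ℕ}
    (h₀ : c (m - 1) = d (m - 1)) (h₁ : c m = d m) (h₂ : c (m + 1) = d (m + 1)) :
    greenLHS A V z c m = greenLHS A V z d m :=
  greenLHS_congr rfl rfl rfl h₀ h₁ h₂

theorem greenLHS_eq_zero_of_cells_eq_zero {c : ℕ → Fin N → ℂ} {m : ℕ}
    (h₀ : c (m - 1) = 0) (h₁ : c m = 0) (h₂ : c (m + 1) = 0) : greenLHS A V z c m = 0 := by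
  simp [greenLHS, h₀, h₁, h₂]

/-- `greenLHS` in cell `m`, as a linear map of the sequence. -/
def greenₗ (A V : ℕ → Matrix (Fin N) (Fin N) ℂ) (z : ℂ) (m : ℕ) : L2 N →ₗ[ℂ] Fin N → ℂ :=
  -((A (m - 1))ᴴ.mulVecLin ∘ₗ cellₗ N (m - 1)) + (z • 1 - V m).mulVecLin ∘ₗ cellₗ N m
    - (A m).mulVecLin ∘ₗ cellₗ N (m + 1)

/-- The sequences that solve the homogeneous equation in the cells `m ≥ k`. -/
def homogeneousFrom (A V : ℕ → Matrix (Fin N) (Fin N) ℂ) (z : ℂ) (k : ℕ) :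
    Submodule ℂ (L2 N) :=
  ⨅ m ≥ k, LinearMap.ker (greenₗ A V z m)

theorem mem_homogeneousFrom {k : ℕ} {ψ : L2 N} :
    ψ ∈ homogeneousFrom A V z k ↔ ∀ m ≥ k, greenLHS A V z (cell ψ) m = 0 := by
  simp only [homogeneousFrom, Submodule.mem_iInf, LinearMap.mem_ker]
  rfl

theorem cellsUpTo_le_homogeneousFrom (K : ℕ) :
    cellsUpTo N K ≤ homogeneousFrom A V z (K + 2) := by
  intro ψ hψ
  rw [mem_cellsUpTo] at hψ
  exact mem_homogeneousFrom.2 fun m hm => greenLHS_eq_zero_of_cells_eq_zero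
    (hψ _ (by lia)) (hψ _ (by lia)) (hψ _ (by lia))

section Resolvent

variable {H : L2 N →L[ℂ] L2 N}
  (hH : ∀ (ψ : L2 N) (m : ℕ), 1 ≤ m → cell (H ψ) m
    = (A (m - 1))ᴴ *ᵥ cell ψ (m - 1) + V m *ᵥ cell ψ m + A m *ᵥ cell ψ (m + 1))
include hH

theorem cell_smul_sub_apply (ψ : L2 N) {m : ℕ} (hm : 1 ≤ m) :
    cell (z • ψ - H ψ) m = greenLHS A V z (cell ψ) m := by
  rw [cell_sub, cell_smul, hH ψ m hm, greenLHS, sub_mulVec, smul_mulVec, one_mulVec]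
  abel

theorem exists_linearEquiv_solvesGreen (hz : z ∉ spectrum ℂ H) :
    ∃ T : L2 N ≃ₗ[ℂ] L2 N, ∀ ψ, SolvesGreen A V z (cell (T ψ)) ψ := by
  have hbij : Function.Bijective (algebraMap ℂ (L2 N →L[ℂ] L2 N) z - H) :=
    ContinuousLinearMap.isUnit_iff_bijective.1 (spectrum.notMem_iff.1 hz)
  exact ⟨.ofBijective _ hbij, fun ψ m hm => (cell_smul_sub_apply hH ψ hm).symm⟩

end Resolvent

end DifferenceEquation

section WellPosed

variable {A V : ℕ → Matrix (Fin N) (Fin N) ℂ} {z : ℂ} {T : L2 N ≃ₗ[ℂ] L2 N}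
  (hT : ∀ ψ, SolvesGreen A V z (cell (T ψ)) ψ)
include hT

theorem solvesGreen_iff_eq_symm_apply {f : ℕ → Fin N → ℂ} {φ : L2 N}
    (hφ : ∀ m, 1 ≤ m → cell φ m = f m) (ψ : L2 N) :
    SolvesGreen A V z f ψ ↔ ψ = T.symm φ := by
  rw [LinearEquiv.eq_symm_apply]
  constructor
  · exact fun hψ => cell_ext fun m hm => by rw [← hT ψ m hm, hψ m hm, hφ m hm]
  · rintro rfl m hm
    rw [hT ψ m hm, hφ m hm]

theorem homogeneousFrom_one_eq_bot : homogeneousFrom A V z 1 = ⊥ := by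
  refine (Submodule.eq_bot_iff _).2 fun ψ hψ => T.map_eq_zero_iff.1 (cell_ext fun m hm => ?_)
  rw [← hT ψ m hm, mem_homogeneousFrom.1 hψ m hm, cell_zero]

theorem homogeneousFrom_succ_eq_map (K : ℕ) :
    homogeneousFrom A V z (K + 1) = (cellsUpTo N K).map (T.symm : L2 N →ₗ[ℂ] L2 N) := by
  rw [← Submodule.comap_equiv_eq_map_symm]
  ext ψ
  rw [mem_homogeneousFrom, Submodule.mem_comap, mem_cellsUpTo]
  exact forall₂_congr fun m hm => by rw [hT ψ m (by lia)]; rfl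

theorem homogeneousFrom_inf_ker_cellPair (k : ℕ) :
    homogeneousFrom A V z (k + 2) ⊓ LinearMap.ker (cellPair N k) = cellsUpTo N k := by
  refine le_antisymm ?_ (le_inf (cellsUpTo_le_homogeneousFrom k) ?_)
  · rintro ψ ⟨hψ, hpair⟩
    obtain ⟨hψ₁, hψ₂⟩ := cellPair_eq_zero_iff.1 hpair
    obtain ⟨φ, hφ⟩ := exists_cell_eq_of_tail (c := fun m => if m ≤ k + 2 then 0 else cell ψ m)
      (k + 2) (k + 2) ψ fun m hm => if_neg (by lia)
    have hφ_le : ∀ m ≤ k + 2, cell φ m = 0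
      | 0, _ => rfl
      | m + 1, hm => by rw [hφ (m + 1) (by lia), if_pos hm]
    have hφ_gt : ∀ m > k, cell φ m = cell ψ m := by
      intro m hm
      obtain rfl | rfl | hm : m = k + 1 ∨ m = k + 2 ∨ k + 2 < m := by lia
      · rw [hφ_le _ (by lia), hψ₁]
      · rw [hφ_le _ le_rfl, hψ₂]
      · rw [hφ m (by lia), if_neg (by lia)]
    have hφ_hom : φ ∈ homogeneousFrom A V z 1 := mem_homogeneousFrom.2 fun m hm => by
      rcases le_or_gt m (k + 1) with hmk | hmk
      · exact greenLHS_eq_zero_of_cells_eq_zero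
          (hφ_le _ (by lia)) (hφ_le _ (by lia)) (hφ_le _ (by lia))
      · rw [← mem_homogeneousFrom.1 hψ m hmk]
        exact greenLHS_eq_of_cells_eq (hφ_gt _ (by lia)) (hφ_gt _ (by lia)) (hφ_gt _ (by lia))
    have hφ_zero : φ = 0 := by
      rwa [homogeneousFrom_one_eq_bot hT, Submodule.mem_bot] at hφ_hom
    refine mem_cellsUpTo.2 fun m hm => ?_
    rw [← hφ_gt m hm, hφ_zero, cell_zero]
  · intro ψ hψ
    rw [mem_cellsUpTo] at hψ
    exact cellPair_eq_zero_iff.2 ⟨hψ _ (by lia), hψ _ (by lia)⟩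

theorem finrank_map_cellPair_homogeneousFrom (k : ℕ) :
    Module.finrank ℂ ((homogeneousFrom A V z (k + 2)).map (cellPair N k)) = N := by
  have hmap := homogeneousFrom_succ_eq_map hT (k + 1)
  have hdim : Module.finrank ℂ (homogeneousFrom A V z (k + 2)) = (k + 1) * N := by
    rw [hmap, LinearEquiv.finrank_map_eq, finrank_cellsUpTo]
  have : FiniteDimensional ℂ (homogeneousFrom A V z (k + 2)) := by
    rw [hmap]
    infer_instance
  have hrn := finrank_map_add_finrank_inf_ker (cellPair N k) (homogeneousFrom A V z (k + 2))
  rw [homogeneousFrom_inf_ker_cellPair hT, finrank_cellsUpTo, hdim] at hrn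
  linarith

end WellPosed

/-- The boundary data `[h_1, h_2]` of the `l²` solutions of the constant-coefficient equation:
the space `V_decaying` of the paper. -/
def decayingSpace (A V : Matrix (Fin N) (Fin N) ℂ) (z : ℂ) : Submodule ℂ (Fin N ⊕ Fin N → ℂ) :=
  (homogeneousFrom (fun _ => A) (fun _ => V) z 2).map (cellPair N 0)

theorem mem_decayingSpace_iff {A V : Matrix (Fin N) (Fin N) ℂ} {z : ℂ} {x : Fin N ⊕ Fin N → ℂ} :
    x ∈ decayingSpace A V z ↔ IsDecayingData A V z x := by
  simp only [decayingSpace, Submodule.mem_map, mem_homogeneousFrom, cellPair_apply,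
    IsDecayingData, eq_comm (a := x)]

namespace IsPeriodicFrom

variable {M : ℕ} {A V : ℕ → Matrix (Fin N) (Fin N) ℂ} {z : ℂ} (hper : IsPeriodicFrom M A V)
include hper

theorem eq_of_le {m : ℕ} (hm : max M 1 ≤ m) : A m = A (max M 1) ∧ V m = V (max M 1) := by
  induction m, hm using Nat.le_induction with
  | base => exact ⟨rfl, rfl⟩
  | succ m hm ih =>
    obtain ⟨hV, hA⟩ := hper m (by lia) (by lia)
    exact ⟨hA.trans ih.1, hV.trans ih.2⟩

theorem greenLHS_add {c d : ℕ → Fin N → ℂ} (hcd : ∀ m, 1 ≤ m → c (m + M) = d m) {m : ℕ}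
    (hm : 2 ≤ m) :
    greenLHS A V z c (m + M)
      = greenLHS (fun _ => A (max M 1)) (fun _ => V (max M 1)) z d m := by
  have hpred : m + M - 1 = m - 1 + M := by lia
  refine greenLHS_congr (hper.eq_of_le (by lia)).1 (hper.eq_of_le (by lia)).1
    (hper.eq_of_le (by lia)).2 ?_ (hcd m (by lia)) ?_
  · rw [hpred, hcd (m - 1) (by lia)]
  · rw [add_right_comm, hcd (m + 1) (by lia)]

theorem mem_homogeneousFrom_iff_of_shift {g h : L2 N}
    (hgh : ∀ m, 1 ≤ m → cell g (m + M) = cell h m) :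
    g ∈ homogeneousFrom A V z (M + 2) ↔
      h ∈ homogeneousFrom (fun _ => A (max M 1)) (fun _ => V (max M 1)) z 2 := by
  rw [mem_homogeneousFrom, mem_homogeneousFrom]
  constructor <;> intro hsol m hm
  · rw [← hper.greenLHS_add hgh hm, hsol (m + M) (by lia)]
  · obtain ⟨m, rfl⟩ := Nat.exists_eq_add_of_le' (show M ≤ m by lia)
    rw [hper.greenLHS_add hgh (by lia), hsol m (by lia)]

theorem exists_mem_homogeneousFrom {u : ℕ → Fin N → ℂ} (hu₀ : u 0 = 0)
    {x : Fin N ⊕ Fin N → ℂ} (hx : x ∈ decayingSpace (A (max M 1)) (V (max M 1)) z) :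
    ∃ g ∈ homogeneousFrom A V z (M + 2), (∀ m ≤ M, cell g m = u m) ∧ cellPair N M g = x := by
  obtain ⟨h, hh, rfl⟩ := hx
  obtain ⟨g, hg⟩ := exists_cell_eq_of_tail (c := fun m => if m ≤ M then u m else cell h (m - M))
    M 0 h fun m hm => by rw [if_neg (by lia), Nat.add_sub_cancel, add_zero]
  have hgh : ∀ m, 1 ≤ m → cell g (m + M) = cell h m := fun m hm => by
    rw [hg _ (by lia), if_neg (by lia), Nat.add_sub_cancel]
  have hgu : ∀ m ≤ M, cell g m = u m
    | 0, _ => hu₀.symm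
    | m + 1, hm => by rw [hg _ (by lia), if_pos hm]
  exact ⟨g, (hper.mem_homogeneousFrom_iff_of_shift hgh).2 hh, hgu, cellPair_eq_of_shift hgh⟩

theorem decayingSpace_eq_map :
    decayingSpace (A (max M 1)) (V (max M 1)) z
      = (homogeneousFrom A V z (M + 2)).map (cellPair N M) := by
  ext x
  constructor
  · intro hx
    obtain ⟨g, hg, -, hgx⟩ := hper.exists_mem_homogeneousFrom (u := 0) rfl hx
    exact ⟨g, hg, hgx⟩
  · rintro ⟨g, hg, rfl⟩
    obtain ⟨h, hh⟩ := exists_cell_eq_of_tail (c := fun m => cell g (m + M)) 0 M g fun _ _ => rfl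
    have hgh : ∀ m, 1 ≤ m → cell g (m + M) = cell h m := fun m hm => (hh m hm).symm
    exact ⟨h, (hper.mem_homogeneousFrom_iff_of_shift hgh).1 hg, (cellPair_eq_of_shift hgh).symm⟩

theorem finrank_decayingSpace {T : L2 N ≃ₗ[ℂ] L2 N}
    (hT : ∀ ψ, SolvesGreen A V z (cell (T ψ)) ψ) :
    Module.finrank ℂ (decayingSpace (A (max M 1)) (V (max M 1)) z) = N := by
  rw [hper.decayingSpace_eq_map, finrank_map_cellPair_homogeneousFrom hT]

theorem solvesTruncated_and_mem_decayingSpace_iff {f : ℕ → Fin N → ℂ} (hf : ∀ m, M < m → f m = 0)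
    (u : Fin (M + 2) → Fin N → ℂ) :
    (SolvesTruncated M A V z f u ∧ Sum.elim (finCell u (M + 1)) (finCell u (M + 2)) ∈
        decayingSpace (A (max M 1)) (V (max M 1)) z) ↔
      ∃ g : L2 N, SolvesGreen A V z f g ∧ ∀ m, 1 ≤ m → m ≤ M + 2 → finCell u m = cell g m := by
  constructor
  · rintro ⟨htr, hu⟩
    obtain ⟨g, hg, hgu, hpair⟩ := hper.exists_mem_homogeneousFrom (u := finCell u) rfl hu
    rw [cellPair_apply, Sum.elim_eq_iff] at hpair
    have hcell : ∀ m ≤ M + 2, finCell u m = cell g m := fun m hm => by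
      obtain hm | rfl | rfl : m ≤ M ∨ m = M + 1 ∨ m = M + 2 := by lia
      exacts [(hgu m hm).symm, hpair.1.symm, hpair.2.symm]
    refine ⟨g, fun m hm => ?_, fun m _ => hcell m⟩
    rcases le_or_gt m (M + 1) with hmM | hmM
    · rw [← htr m hm hmM]
      exact (greenLHS_eq_of_cells_eq
        (hcell _ (by lia)) (hcell _ (by lia)) (hcell _ (by lia))).symm
    · rw [mem_homogeneousFrom.1 hg m hmM, hf m (by lia)]
  · rintro ⟨g, hg, hu⟩
    have hcell : ∀ m ≤ M + 2, finCell u m = cell g m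
      | 0, _ => rfl
      | m + 1, hm => hu (m + 1) (by lia) hm
    refine ⟨fun m hm hmM => ?_, ?_⟩
    · rw [← hg m hm]
      exact greenLHS_eq_of_cells_eq (hcell _ (by lia)) (hcell _ (by lia)) (hcell _ (by lia))
    · rw [hcell _ (by lia), hcell _ le_rfl, ← cellPair_apply, hper.decayingSpace_eq_map]
      exact Submodule.mem_map_of_mem <| mem_homogeneousFrom.2 fun m hm => by
        rw [hg m (by lia), hf m (by lia)]

end IsPeriodicFrom

end EventuallyPeriodic

end

open EventuallyPeriodic in
theorem theorem4p3_general {N : ℕ} (M : ℕ) (A V : ℕ → Matrix (Fin N) (Fin N) ℂ)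
    (H : L2 N →L[ℂ] L2 N)
    (hH : ∀ (ψ : L2 N) (m : ℕ), 1 ≤ m → cell (H ψ) m
      = (A (m - 1))ᴴ *ᵥ cell ψ (m - 1) + V m *ᵥ cell ψ m + A m *ᵥ cell ψ (m + 1))
    (hper : IsPeriodicFrom M A V)
    (Ainf Vinf : Matrix (Fin N) (Fin N) ℂ)
    (hAinf : Ainf = A (max M 1)) (hVinf : Vinf = V (max M 1))
    (z : ℂ) (hz : z ∉ spectrum ℂ H) :
    ∃ Vdecaying : Submodule ℂ (Fin N ⊕ Fin N → ℂ),
      Module.finrank ℂ Vdecaying = N ∧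
      (∀ x, x ∈ Vdecaying ↔ IsDecayingData Ainf Vinf z x) ∧
      ∀ f : ℕ → Fin N → ℂ, (∀ m, M < m → f m = 0) →
        ∃ g : L2 N, (∀ g' : L2 N, SolvesGreen A V z f g' ↔ g' = g) ∧
          ∀ u : Fin (M + 2) → Fin N → ℂ,
            (SolvesTruncated M A V z f u ∧
                Sum.elim (finCell u (M + 1)) (finCell u (M + 2)) ∈ Vdecaying) ↔
              ∀ m, 1 ≤ m → m ≤ M + 2 → finCell u m = cell g m := by
  subst hAinf hVinf
  obtain ⟨T, hT⟩ := exists_linearEquiv_solvesGreen hH hz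
  refine ⟨decayingSpace (A (max M 1)) (V (max M 1)) z, hper.finrank_decayingSpace hT,
    fun x => mem_decayingSpace_iff, fun f hf => ?_⟩
  obtain ⟨φ, hφ⟩ := exists_cell_eq_of_forall_lt_eq_zero hf
  have hsolves := solvesGreen_iff_eq_symm_apply hT hφ
  refine ⟨T.symm φ, hsolves, fun u => ?_⟩
  simp only [hper.solvesTruncated_and_mem_decayingSpace_iff hf, hsolves, exists_eq_left]

open EventuallyPeriodic in
theorem theorem4p3 {N : ℕ} (M : ℕ) (A V : ℕ → Matrix (Fin N) (Fin N) ℂ)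
    (H : L2 N →L[ℂ] L2 N) (hH : IsNearestNeighbour H A V) (hper : IsPeriodicFrom M A V)
    (Ainf Vinf : Matrix (Fin N) (Fin N) ℂ)
    (hAinf : Ainf = A (max M 1)) (hVinf : Vinf = V (max M 1))
    (z : ℂ) (hz : z ∉ spectrum ℂ H)
    (hS : ¬ IsUnit (SMatrix Ainf Vinf z) → HasSingularForm (SMatrix Ainf Vinf z)) :
    ∃ Vdecaying : Submodule ℂ (Fin N ⊕ Fin N → ℂ),
      Module.finrank ℂ Vdecaying = N ∧
      (∀ x, x ∈ Vdecaying ↔ IsDecayingData Ainf Vinf z x) ∧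
      ∀ f : ℕ → Fin N → ℂ, (∀ m, M < m → f m = 0) →
        ∃ g : L2 N, (∀ g' : L2 N, SolvesGreen A V z f g' ↔ g' = g) ∧
          ∀ u : Fin (M + 2) → Fin N → ℂ,
            (SolvesTruncated M A V z f u ∧
                Sum.elim (finCell u (M + 1)) (finCell u (M + 2)) ∈ Vdecaying) ↔
              ∀ m, 1 ≤ m → m ≤ M + 2 → finCell u m = cell g m := by
  exact theorem4p3_general M A V H hH.action hper Ainf Vinf hAinf hVinf z hz
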